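/- Let $H$ be a complex Hilbert space and $P(H)$ the complete orthomodular lattice of its orthogonal projections (closed subspaces), with orthocomplement $a\mapsto a^{\perp}$. Let $\mathcal B$ be the set of complete Boolean subalgebras $B$ of $P(H)$, ordered by inclusion; for $B\in\mathcal B$ let $\Omega_B$ be its Stone space (the Boolean homomorphisms $B\to\{0,1\}$, with basic open sets $\{x : x(b)=1\}$, $b\in B$). The spectral presheaf $\underline\Omega$ is $B\mapsto\Omega_B$ with the restriction maps. A clopen subobject $S$ is a family of clopen sets $S_B\subseteq\Omega_B$ such that $x\in S_B$ and $B'\subseteq B$ imply $x|_{B'}\in S_{B'}$. Ordered by componentwise inclusion, the clopen subobjects form a complete Heyting algebra $A=\mathrm{Sub}_{cl}(\underline\Omega)$. For $a\in P(H)$ let $\delta(a)\in A$ be given by $\delta(a)_B=\{x\in\Omega_B : x(\bigwedge\{b\in B: b\ge a\})=1\}$, and for $S\in A$ put $$\varepsilon(S)=\bigvee\{a\in P(H):\delta(a)\le S\},\qquad S^{*}=\delta(\varepsilon(S)^{\perp}),\qquad S\Rightarrow_{*}T\;=\;S^{*}\vee T .$$ Let $E$ be the set of classes $[S]$ for the relation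 $S\sim T\iff\varepsilon(S)=\varepsilon(T)$, and let $g:E\to P(H)$, $g([S])=\varepsilon(S)$ (the Döring–Cannon isomorphism). Let $V^{(A)}$ be the Heyting valued universe over $A$, with $$\|x\in v\|=\bigvee_{y\in \mathrm{dom}(v)}v(y)\wedge\|x=y\|,\qquad \|u=v\|=\bigwedge_{x\in \mathrm{dom}(u)}(u(x)\Rightarrow\|x\in v\|)\wedge\bigwedge_{y\in \mathrm{dom}(v)}(v(y)\Rightarrow\|y\in u\|),$$ where $\Rightarrow$ is the Heyting implication, and let $\hat q$ be the standard name of $q\in\mathbb Q$. Let $\mathbb R^{(A)}$ be the set of all $u\in V^{(A)}$ such that the statement "$u$ is a Dedekind real" has truth value $\top$, that is, the statement "$u\subseteq\hat{\mathbb Q}$, some rational is in $u$, some rational is not in $u$, and for every rational $q$: $q\in u$ if and only if $r\in u$ for all rationals $r>q$". For $u\in\mathbb R^{(A)}$ and $\lambda\in\mathbb R$ put $$E^{u}_{\lambda}=\bigwedge_{q\in\mathbb Q,\ q>\lambda}\|\hat q\in u\|,\qquad G^{u}_{\lambda}=g([E^{u}_{\lambda}])\in P(H).$$ Let $WSA(H)$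 be the set of weakly self-adjoint operators on $H$, i.e. of weakly right-continuous spectral families: families $(F_\lambda)_{\lambda\in\mathbb R}$ in $P(H)$ with $\bigwedge_\lambda F_\lambda=0$ and $\bigwedge_{\mu>\lambda}F_\mu=F_\lambda$ for all $\lambda$ (it is not required that $\bigvee_\lambda F_\lambda=1$). Then $G(u)=(G^{u}_{\lambda})_{\lambda\in\mathbb R}$ defines a map $G:\mathbb R^{(A)}\to WSA(H)$, and $G$ is injective with respect to the equality of $V^{(A)}$ computed with $*$ in place of the Heyting negation. Precisely: let $\|u=v\|_{*}$ be defined by the same recursion as above with $\Rightarrow_{*}$ in place of $\Rightarrow$ throughout. Then for all $u,v\in\mathbb R^{(A)}$: 1. if $\|u=v\|_{*}\neq\top$, then $G(u)\neq G(v)$; 2. if $\bigwedge_{q\in\mathbb Q}\big((\|\hat q\in u\|\Rightarrow_{*}\|\hat q\in v\|)\wedge(\|\hat q\in v\|\Rightarrow_{*}\|\hat q\in u\|)\big)\neq\top$, the truth value under $\Rightarrow_{*}$ of "$u$ and $v$ contain the same rationals", then $G(u)\neq G(v)$. -/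

import Mathlib

universe u

/-! ## Complete orthomodular lattices and the projection lattice of a Hilbert space -/

/-- Complete orthomodular lattices; `aᶜ` is the orthocomplement of `a`. -/
class CompleteOrthomodularLattice (L : Type u) extends CompleteLattice L, Compl L where
  inf_ocompl_self : ∀ a : L, a ⊓ aᶜ = ⊥
  sup_ocompl_self : ∀ a : L, a ⊔ aᶜ = ⊤
  ocompl_ocompl : ∀ a : L, aᶜᶜ = a
  ocompl_le_ocompl : ∀ a b : L, a ≤ b → bᶜ ≤ aᶜ
  orthomodular : ∀ a b : L, a ≤ b → a ⊔ (aᶜ ⊓ b) = b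

/-- The projection lattice `P(H)` of a complex Hilbert space `H`, every orthogonal projection being
identified with its range, a closed linear subspace. Infima are intersections, suprema are closed
linear spans. -/
abbrev ProjLattice (H : Type u) [NormedAddCommGroup H] [InnerProductSpace ℂ H] : Type u :=
  ClosedSubmodule ℂ H

theorem ProjLattice.orthomodular_aux {H : Type u} [NormedAddCommGroup H] [InnerProductSpace ℂ H]
    [CompleteSpace H] (a b : ProjLattice H) (h : a ≤ b) : a ⊔ (aᗮ ⊓ b) = b := by
  apply le_antisymm (sup_le h inf_le_right)
  intro x hx
  have hc : CompleteSpace a.toSubmodule := a.isClosed.completeSpace_coe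
  have h1 : a.toSubmodule ⊔ (a.toSubmoduleᗮ ⊓ b.toSubmodule) = b.toSubmodule :=
    Submodule.sup_orthogonal_inf_of_hasOrthogonalProjection h
  have hx' : x ∈ a.toSubmodule ⊔ (a.toSubmoduleᗮ ⊓ b.toSubmodule) := by rw [h1]; exact hx
  obtain ⟨y, hy, z, hz, rfl⟩ := Submodule.mem_sup.1 hx'
  have hy' : y ∈ a ⊔ (aᗮ ⊓ b) := (le_sup_left : a ≤ a ⊔ (aᗮ ⊓ b)) hy
  have hz' : z ∈ a ⊔ (aᗮ ⊓ b) := (le_sup_right : aᗮ ⊓ b ≤ a ⊔ (aᗮ ⊓ b)) hz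
  exact add_mem hy' hz'

/-- The orthocomplement on `P(H)` is the orthogonal complement of closed subspaces. -/
noncomputable instance ProjLattice.instCompleteOrthomodularLattice (H : Type u)
    [NormedAddCommGroup H] [InnerProductSpace ℂ H] [CompleteSpace H] :
    CompleteOrthomodularLattice (ProjLattice H) where
  __ := (inferInstance : CompleteLattice (ClosedSubmodule ℂ H))
  compl a := aᗮ
  inf_ocompl_self a := by
    refine le_antisymm (fun x hx => ?_) bot_le
    obtain ⟨h1, h2⟩ : x ∈ a ∧ x ∈ a.toSubmoduleᗮ := hx
    have h0 : inner ℂ x x = 0 := h2 x h1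
    rw [inner_self_eq_zero] at h0
    rw [h0]
    exact zero_mem (⊥ : ClosedSubmodule ℂ H)
  sup_ocompl_self a := by
    have := ProjLattice.orthomodular_aux a ⊤ le_top
    rwa [inf_top_eq] at this
  ocompl_ocompl a := by
    ext x
    have hc : CompleteSpace a.toSubmodule := a.isClosed.completeSpace_coe
    have : a.toSubmoduleᗮᗮ = a.toSubmodule := Submodule.orthogonal_orthogonal _
    change x ∈ a.toSubmoduleᗮᗮ ↔ x ∈ a.toSubmodule
    rw [this]
  ocompl_le_ocompl a b h := ClosedSubmodule.orthogonal_le h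
  orthomodular a b h := ProjLattice.orthomodular_aux a b h

/-! ## The spectral presheaf -/

/-- A complete Boolean subalgebra `B` of `L`: it contains all suprema and infima (taken in `L`) of
its subsets and the orthocomplements of its elements, and it is distributive. These are the
contexts over which the spectral presheaf lives; completeness makes
`⋀ {b ∈ B | a ≤ b}` an element of `B`. -/
structure BoolContext (L : Type u) [CompleteOrthomodularLattice L] where
  alg : CompleteSublattice L
  compl_mem : ∀ a ∈ alg, aᶜ ∈ alg
  distrib : ∀ a ∈ alg, ∀ b ∈ alg, ∀ c ∈ alg, a ⊓ (b ⊔ c) = (a ⊓ b) ⊔ (a ⊓ c)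

/-- The Stone space `Ω_B`: homomorphisms of bounded lattices from `B` to `{0, 1}`, that is, Boolean
homomorphisms (preservation of complements is automatic). -/
def StoneSpace {L : Type u} [CompleteOrthomodularLattice L] (B : BoolContext L) : Type u :=
  BoundedLatticeHom B.alg Bool

namespace StoneSpace

variable {L : Type u} [CompleteOrthomodularLattice L] {B : BoolContext L}

/-- The value `x(b) ∈ {0, 1}`. -/
noncomputable def eval (x : StoneSpace B) (b : B.alg) : Bool := BoundedLatticeHom.toLatticeHom x b

/-- The basic set `U_b = {x | x(b) = 1}`. -/
def basic (b : B.alg) : Set (StoneSpace B) := {x | x.eval b = true}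

/-- The Stone topology, generated by the sets `U_b`. -/
instance : TopologicalSpace (StoneSpace B) :=
  TopologicalSpace.generateFrom (Set.range (basic (B := B)))

/-- Restriction of homomorphisms along an inclusion `B' ⊆ B`. -/
noncomputable def restrict {B' : BoolContext L} (h : B'.alg ≤ B.alg) (x : StoneSpace B) : StoneSpace B' where
  toFun b := x.eval ⟨b.1, h b.2⟩
  map_sup' a b := map_sup (BoundedLatticeHom.toLatticeHom x) (⟨a.1, h a.2⟩ : B.alg) (⟨b.1, h b.2⟩ : B.alg)
  map_inf' a b := map_inf (BoundedLatticeHom.toLatticeHom x) (⟨a.1, h a.2⟩ : B.alg) (⟨b.1, h b.2⟩ : B.alg)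
  map_top' := BoundedLatticeHom.map_top' x
  map_bot' := BoundedLatticeHom.map_bot' x

theorem eval_restrict {B' : BoolContext L} (h : B'.alg ≤ B.alg) (x : StoneSpace B) (b : B'.alg) :
    (restrict h x).eval b = x.eval ⟨b.1, h b.2⟩ := rfl

theorem eval_mono (x : StoneSpace B) {a b : B.alg} (h : a ≤ b) (ha : x.eval a = true) :
    x.eval b = true := by
  have h2 : x.eval a ≤ x.eval b := OrderHomClass.mono (BoundedLatticeHom.toLatticeHom x) h
  rw [ha] at h2
  exact top_le_iff.1 h2

theorem eval_inf (x : StoneSpace B) (a b : B.alg) : x.eval (a ⊓ b) = (x.eval a && x.eval b) :=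
  map_inf (BoundedLatticeHom.toLatticeHom x) a b

theorem eval_sup (x : StoneSpace B) (a b : B.alg) : x.eval (a ⊔ b) = (x.eval a || x.eval b) :=
  map_sup (BoundedLatticeHom.toLatticeHom x) a b

theorem eval_top (x : StoneSpace B) : x.eval ⊤ = true := BoundedLatticeHom.map_top' x

theorem eval_bot (x : StoneSpace B) : x.eval ⊥ = false := BoundedLatticeHom.map_bot' x

/-- The orthocomplement inside a context. -/
def ctxCompl (a : B.alg) : B.alg := ⟨a.1ᶜ, B.compl_mem _ a.2⟩

theorem inf_ctxCompl (a : B.alg) : a ⊓ ctxCompl a = ⊥ :=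
  Subtype.ext (CompleteOrthomodularLattice.inf_ocompl_self a.1)

theorem sup_ctxCompl (a : B.alg) : a ⊔ ctxCompl a = ⊤ :=
  Subtype.ext (CompleteOrthomodularLattice.sup_ocompl_self a.1)

theorem eval_ctxCompl (x : StoneSpace B) (a : B.alg) : x.eval (ctxCompl a) = !x.eval a := by
  have h1 := eval_inf x a (ctxCompl a)
  have h2 := eval_sup x a (ctxCompl a)
  rw [inf_ctxCompl, eval_bot] at h1
  rw [sup_ctxCompl, eval_top] at h2
  revert h1 h2
  cases x.eval a <;> cases x.eval (ctxCompl a) <;> simp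

theorem isOpen_basic (b : B.alg) : IsOpen (basic b) :=
  TopologicalSpace.isOpen_generateFrom_of_mem ⟨b, rfl⟩

theorem isClopen_basic (b : B.alg) : IsClopen (basic b) := by
  refine ⟨⟨?_⟩, isOpen_basic b⟩
  have : (basic b)ᶜ = basic (ctxCompl b) := by
    ext x; simp [basic, eval_ctxCompl]
  rw [this]
  exact isOpen_basic _

theorem exists_basic {U : Set (StoneSpace B)} (hU : IsOpen U) {x : StoneSpace B} (hx : x ∈ U) :
    ∃ b : B.alg, x ∈ basic b ∧ basic b ⊆ U := by
  induction hU with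
  | basic s hs => obtain ⟨b, rfl⟩ := hs; exact ⟨b, hx, subset_rfl⟩
  | univ => exact ⟨⊤, eval_top x, Set.subset_univ _⟩
  | inter s t _ _ ihs iht =>
    obtain ⟨b, hb, hbs⟩ := ihs hx.1
    obtain ⟨c, hc, hct⟩ := iht hx.2
    refine ⟨b ⊓ c, ?_, fun y hy => ⟨hbs ?_, hct ?_⟩⟩
    · change x.eval (b ⊓ c) = true
      have hb' : x.eval b = true := hb
      have hc' : x.eval c = true := hc
      simp [eval_inf, hb', hc']
    · exact eval_mono y inf_le_left hy
    · exact eval_mono y inf_le_right hy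
  | sUnion S _ ih =>
    obtain ⟨s, hs, hxs⟩ := hx
    obtain ⟨b, hb, hbs⟩ := ih s hs hxs
    exact ⟨b, hb, hbs.trans (Set.subset_sUnion_of_mem hs)⟩

theorem continuous_restrict {B' : BoolContext L} (h : B'.alg ≤ B.alg) :
    Continuous (restrict (B := B) (B' := B') h) := by
  refine continuous_generateFrom_iff.2 ?_
  rintro _ ⟨b, rfl⟩
  exact isOpen_basic (B := B) ⟨b.1, h b.2⟩

/-- The distributive lattice structure of a context. -/
@[reducible] def distribLattice (B : BoolContext L) : DistribLattice B.alg :=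
  DistribLattice.ofInfSupLe fun a b c =>
    le_of_eq (Subtype.ext (B.distrib a.1 a.2 b.1 b.2 c.1 c.2))

/-- Stone separation: every nonzero element of a context takes the value `1` somewhere. -/
theorem basic_nonempty {b : B.alg} (hb : b ≠ ⊥) : (basic b).Nonempty := by
  classical
  let _ : DistribLattice B.alg := distribLattice B
  have hd : Disjoint ((Order.PFilter.principal b : Order.PFilter B.alg) : Set B.alg)
      ((Order.Ideal.principal (⊥ : B.alg) : Order.Ideal B.alg) : Set B.alg) := by
    rw [Set.disjoint_left]
    intro x hx hx'
    have h1 : b ≤ x := hx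
    have h2 : x ≤ ⊥ := hx'
    exact hb (le_bot_iff.1 (h1.trans h2))
  obtain ⟨J, hJ, -, hJd⟩ := DistribLattice.prime_ideal_of_disjoint_filter_ideal hd
  have hbot : (⊥ : B.alg) ∈ J := J.bot_mem
  have htop : (⊤ : B.alg) ∉ J := fun h =>
    Set.disjoint_left.1 hJd (show (⊤ : B.alg) ∈ (Order.PFilter.principal b : Set B.alg) from
      (le_top : b ≤ ⊤)) h
  have hbJ : b ∉ J := fun h =>
    Set.disjoint_left.1 hJd (show b ∈ (Order.PFilter.principal b : Set B.alg) from le_refl b) h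
  let x : BoundedLatticeHom B.alg Bool :=
    { toFun := fun a => decide (a ∉ J)
      map_sup' := by
        intro a c
        have : a ⊔ c ∈ J ↔ a ∈ J ∧ c ∈ J := Order.Ideal.sup_mem_iff
        by_cases h1 : a ∈ J <;> by_cases h2 : c ∈ J <;> simp [this, h1, h2]
      map_inf' := by
        intro a c
        have : a ⊓ c ∈ J ↔ a ∈ J ∨ c ∈ J :=
          ⟨fun h => hJ.mem_or_mem h, fun h => h.elim (fun h => J.lower inf_le_left h)
            (fun h => J.lower inf_le_right h)⟩
        by_cases h1 : a ∈ J <;> by_cases h2 : c ∈ J <;> simp [this, h1, h2]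
      map_top' := by simp [htop]
      map_bot' := by simp [hbot] }
  exact ⟨x, show decide (b ∉ J) = true by simp [hbJ]⟩

/-- The Stone space of a complete Boolean algebra is extremally disconnected. -/
theorem isClopen_closure {U : Set (StoneSpace B)} (hU : IsOpen U) : IsClopen (closure U) := by
  suffices h : closure U = basic (sSup {c : B.alg | basic c ⊆ U}) by
    rw [h]; exact isClopen_basic _
  apply subset_antisymm
  · refine closure_minimal (fun x hx => ?_) (isClopen_basic _).1
    obtain ⟨c, hxc, hc⟩ := exists_basic hU hx
    exact eval_mono x (le_sSup hc) hxc
  · intro x hx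
    rw [mem_closure_iff]
    intro V hV hxV
    obtain ⟨d, hxd, hd⟩ := exists_basic hV hxV
    by_contra hne
    have hle : sSup {c : B.alg | basic c ⊆ U} ≤ ctxCompl d := by
      refine sSup_le fun c hc => ?_
      have hcd : c ⊓ d = ⊥ := by
        by_contra h0
        obtain ⟨y, hy⟩ := basic_nonempty h0
        exact hne ⟨y, hd (eval_mono y inf_le_right hy), hc (eval_mono y inf_le_left hy)⟩
      let _ : DistribLattice B.alg := distribLattice B
      calc c = c ⊓ (d ⊔ ctxCompl d) := by rw [sup_ctxCompl]; simp
        _ = (c ⊓ d) ⊔ (c ⊓ ctxCompl d) := inf_sup_left _ _ _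
        _ = c ⊓ ctxCompl d := by rw [hcd]; simp
        _ ≤ ctxCompl d := inf_le_right
    have h1 := eval_mono x hle hx
    rw [eval_ctxCompl] at h1
    have h2 : x.eval d = true := hxd
    simp [h2] at h1

end StoneSpace

/-- A clopen subobject of the spectral presheaf: a clopen subset of every `Ω_B`, compatible with
restriction. -/
@[ext] structure SubCl (L : Type u) [CompleteOrthomodularLattice L] where
  obj : ∀ B : BoolContext L, Set (StoneSpace B)
  isClopen : ∀ B, IsClopen (obj B)
  restrict_mem : ∀ (B B' : BoolContext L) (h : B'.alg ≤ B.alg) (x : StoneSpace B),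
    x ∈ obj B → StoneSpace.restrict h x ∈ obj B'

namespace SubCl

variable {L : Type u} [CompleteOrthomodularLattice L]

/-- Clopen subobjects are ordered by componentwise inclusion. -/
instance : PartialOrder (SubCl L) where
  le S T := ∀ B, S.obj B ⊆ T.obj B
  le_refl _ _ := subset_rfl
  le_trans _ _ _ h1 h2 B := (h1 B).trans (h2 B)
  le_antisymm S T h1 h2 := SubCl.ext (funext fun B => subset_antisymm (h1 B) (h2 B))

/-- The supremum is the componentwise closure of the union. -/
instance : SupSet (SubCl L) where
  sSup A :=
    { obj := fun B => closure (⋃ S ∈ A, S.obj B)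
      isClopen := fun B => StoneSpace.isClopen_closure
        (isOpen_biUnion fun S _ => (S.isClopen B).2)
      restrict_mem := fun B B' h x hx => by
        refine map_mem_closure (StoneSpace.continuous_restrict h) hx ?_
        intro y hy
        simp only [Set.mem_iUnion] at hy ⊢
        obtain ⟨S, hS, hy⟩ := hy
        exact ⟨S, hS, S.restrict_mem B B' h y hy⟩ }

/-- The binary infimum is the componentwise intersection. -/
instance : Min (SubCl L) where
  min S T :=
    { obj := fun B => S.obj B ∩ T.obj B
      isClopen := fun B => (S.isClopen B).inter (T.isClopen B)
      restrict_mem := fun B B' h x hx =>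
        ⟨S.restrict_mem B B' h x hx.1, T.restrict_mem B B' h x hx.2⟩ }

theorem isLUB_sSup' (A : Set (SubCl L)) : IsLUB A (sSup A) := by
  refine ⟨fun S hS B => ?_, fun T hT B => ?_⟩
  · exact (Set.subset_biUnion_of_mem (u := fun S : SubCl L => S.obj B) hS).trans subset_closure
  · exact closure_minimal (Set.iUnion₂_subset fun S hS => hT hS B) (T.isClopen B).1

/-- `Sub_cl(Ω)` is a complete lattice. -/
instance : CompleteLattice (SubCl L) where
  __ := completeLatticeOfSup (SubCl L) isLUB_sSup'
  inf := (· ⊓ ·)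
  inf_le_left _ _ _ := Set.inter_subset_left
  inf_le_right _ _ _ := Set.inter_subset_right
  le_inf _ _ _ h1 h2 B := Set.subset_inter (h1 B) (h2 B)

/-- `Sub_cl(Ω)` is a complete Heyting algebra; `⇨` is its Heyting implication. -/
instance : Order.Frame (SubCl L) := Order.Frame.ofMinimalAxioms
  { inf_sSup_le_iSup_inf := by
      intro S A B x hx
      obtain ⟨h1, h2⟩ : x ∈ S.obj B ∧ x ∈ closure (⋃ T ∈ A, T.obj B) := hx
      have h3 := (S.isClopen B).2.inter_closure ⟨h1, h2⟩
      refine closure_minimal ?_ ((⨆ T ∈ A, S ⊓ T).isClopen B).1 h3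
      rintro y ⟨hy1, hy2⟩
      simp only [Set.mem_iUnion] at hy2
      obtain ⟨T, hT, hy2⟩ := hy2
      exact (le_iSup₂_of_le (f := fun T (_ : T ∈ A) => S ⊓ T) T hT le_rfl) B ⟨hy1, hy2⟩ }

/-- The outer daseinisation of `a`: at `B` it is the clopen set `{x | x(⋀ {b ∈ B | a ≤ b}) = 1}`. -/
def das (a : L) : SubCl L where
  obj B := StoneSpace.basic (sInf {b : B.alg | a ≤ b.1})
  isClopen B := StoneSpace.isClopen_basic _
  restrict_mem B B' h x hx := by
    change x.eval _ = true
    refine StoneSpace.eval_mono x ?_ hx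
    refine sInf_le ?_
    change a ≤ ((sInf {b : B'.alg | a ≤ b.1} : B'.alg) : L)
    rw [CompleteSublattice.coe_sInf']
    exact le_iInf₂ fun b hb => hb

/-- `ε(S) = ⋁ {a | δ(a) ≤ S}`, the upper adjoint of daseinisation. -/
def eps (S : SubCl L) : L := sSup {a : L | das a ≤ S}

/-- The negation `S* = δ(ε(S)ᶜ)`. -/
def star (S : SubCl L) : SubCl L := das (eps S)ᶜ

/-- The implication `S ⇒ T = S* ⊔ T` belonging to the negation `*`. -/
def starImp (S T : SubCl L) : SubCl L := star S ⊔ T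

/-- `S ∼ T` if and only if `ε(S) = ε(T)`. -/
def epsSetoid (L : Type u) [CompleteOrthomodularLattice L] : Setoid (SubCl L) where
  r S T := eps S = eps T
  iseqv := ⟨fun _ => rfl, fun h => h.symm, fun h1 h2 => h1.trans h2⟩

/-- The set `E` of `ε`-equivalence classes of clopen subobjects. -/
def EpsClass (L : Type u) [CompleteOrthomodularLattice L] : Type u := Quotient (epsSetoid L)

/-- The class `[S]`. -/
def toClass (S : SubCl L) : EpsClass L := Quotient.mk (epsSetoid L) S

/-- The map `g : E → L`, `g([S]) = ε(S)`. -/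
def EpsClass.g (c : EpsClass L) : L := Quotient.lift (s := epsSetoid L) eps (fun _ _ h => h) c

end SubCl

/-! ## Algebra valued sets -/

/-- The universe `V^(A)` of `A`-valued sets: such a set is a family of `A`-valued sets (its domain)
together with a truth value in `A` for every member of the family. -/
inductive AName (A : Type u) : Type (u + 1)
  | mk (ι : Type u) (dom : ι → AName A) (val : ι → A) : AName A

namespace AName

variable {A : Type u}

/-- The index type of the domain of `u`. -/
def Idx : AName A → Type u
  | mk ι _ _ => ι

/-- The members of the domain of `u`. -/
def dom : (u : AName A) → u.Idx → AName A
  | mk _ d _ => d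

/-- The values of `u` on its domain. -/
def val : (u : AName A) → u.Idx → A
  | mk _ _ a => a

/-- The truth value `‖u = v‖`, the implication of the algebra being `imp`:
`⋀_{x ∈ dom u} (u(x) ⇒ ‖x ∈ v‖) ⊓ ⋀_{y ∈ dom v} (v(y) ⇒ ‖y ∈ u‖)`, where
`‖x ∈ v‖ = ⋁_{y ∈ dom v} v(y) ⊓ ‖x = y‖`. -/
def eqVal [CompleteLattice A] (imp : A → A → A) : AName A → AName A → A
  | mk ι x a, mk κ y b =>
    (⨅ i : ι, imp (a i) (⨆ j : κ, b j ⊓ eqVal imp (x i) (y j))) ⊓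
      (⨅ j : κ, imp (b j) (⨆ i : ι, a i ⊓ eqVal imp (x i) (y j)))

/-- The truth value `‖x ∈ v‖ = ⋁_{y ∈ dom v} v(y) ⊓ ‖x = y‖`. -/
def memVal [CompleteLattice A] (imp : A → A → A) (x v : AName A) : A :=
  ⨆ j : v.Idx, v.val j ⊓ eqVal imp x (v.dom j)

/-- The standard name of a set of the ground universe. -/
def check [CompleteLattice A] : PSet.{u} → AName A
  | PSet.mk ι x => mk ι (fun i => check (x i)) (fun _ => ⊤)

end AName

/-- The Kuratowski pair of two sets. -/
def setPair (x y : PSet.{u}) : PSet.{u} := {{x}, {x, y}}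

/-- A rational number as a hereditarily finite set: the fraction `n / d` in lowest terms is the pair
of the integer `n`, itself the pair of its positive and negative parts, and the von Neumann
natural number `d`. -/
def ratSet (q : ℚ) : PSet.{u} :=
  setPair (setPair (PSet.ofNat q.num.toNat) (PSet.ofNat (-q.num).toNat)) (PSet.ofNat q.den)

/-- The set of all rational numbers. -/
def ratsSet : PSet.{u} := ⟨ULift.{u} ℚ, fun q => ratSet q.down⟩

namespace AName

variable {A : Type u} [Order.Frame A]

/-- `‖q̂ ∈ u‖`, in the Heyting valued universe. -/
def ratMem (u : AName A) (q : ℚ) : A := memVal (· ⇨ ·) (check (ratSet q)) u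

/-- The truth value, in the Heyting valued universe, of "`u` is a Dedekind real", where a real is the
upper part of a Dedekind cut of the rationals, containing its infimum if that is rational:
`u ⊆ ℚ`, some rational is in `u`, some rational is not in `u`, and
`q ∈ u ↔ ∀ r > q, r ∈ u` for every rational `q`.
(Bounded quantifiers over the standard name of `ℚ` are infima and suprema over `ℚ`.) -/
def dedekindVal (u : AName A) : A :=
  (⨅ i : u.Idx, u.val i ⇨ memVal (· ⇨ ·) (u.dom i) (check ratsSet)) ⊓
  (⨆ q : ℚ, ratMem u q) ⊓
  (⨆ q : ℚ, (ratMem u q)ᶜ) ⊓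
  (⨅ q : ℚ, (ratMem u q ⇨ ⨅ (r : ℚ) (_ : q < r), ratMem u r) ⊓
    ((⨅ (r : ℚ) (_ : q < r), ratMem u r) ⇨ ratMem u q))

/-- The set `ℝ^(A)` of the `u` in `V^(A)` that are Dedekind reals with truth value `⊤`. -/
def DedekindReal (A : Type u) [Order.Frame A] : Type (u + 1) := {u : AName A // dedekindVal u = ⊤}

/-- The family `E_t = ⋀ {‖q̂ ∈ u‖ : q rational, q > t}`, `t` real. -/
def family (u : AName A) (t : ℝ) : A := ⨅ (q : ℚ) (_ : t < (q : ℝ)), ratMem u q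

end AName

/-! ## Weakly self-adjoint operators -/

/-- `WSA(H)`: the weakly self-adjoint operators on `H`, that is, the weakly right-continuous spectral
families of projections on `H`. Compared with a right-continuous spectral family, the
condition `⋁_t F_t = 1` is dropped. -/
@[ext] structure WSA (H : Type u) [NormedAddCommGroup H] [InnerProductSpace ℂ H] where
  proj : ℝ → ProjLattice H
  iInf_eq : ⨅ t, proj t = ⊥
  right_cont : ∀ t, ⨅ (s : ℝ) (_ : t < s), proj s = proj t

/-! ## Contexts and clopen subobjects -/

namespace BoolContext

variable {L : Type u} [CompleteOrthomodularLattice L]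

/-! Daseinisation is left adjoint to `eps` (`gc_das_eps`), so `eps` preserves infima; with `eps_bot`
this makes `eps` of the family of a real a weakly right-continuous spectral family.

For injectivity, the implication belonging to `*` takes the value `⊤` very easily: `das aᶜ ⊔ das a =
⊤`, hence `starImp S T = ⊤` as soon as `das (eps S) ≤ T` (`starImp_eq_top`). In particular `eps S =
eps T` suffices. If two reals have the same spectral family, then `eps` agrees on their truth values
at every rational, and the second claim follows at once.

The first claim concerns arbitrary members `x` of `u`, not only standard rationals. A nonempty
clopen subobject is nonempty over the context `{⊥, ⊤}`, whose Stone space has at most one point, so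
the frame has no zero divisors. The values `‖x = q̂‖` are pairwise disjoint, so at most one is
nonzero, and `u(x) ≤ ‖x = q̂‖` for a single `q`. Then `das (eps (u(x)))` lies below `‖x = q̂‖` and
below `‖q̂ ∈ v‖`, hence below the Heyting value `‖x ∈ v‖`. That value only grows when `⇨` is
replaced by `starImp` (`eqVal_le_eqVal`). -/

theorem ocompl_bot : (⊥ : L)ᶜ = ⊤ := by
  simpa using CompleteOrthomodularLattice.sup_ocompl_self (⊥ : L)

theorem ocompl_top : (⊤ : L)ᶜ = ⊥ := by
  simpa using CompleteOrthomodularLattice.inf_ocompl_self (⊤ : L)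

/-- The smallest context `{⊥, ⊤}`. -/
def trivial (L : Type u) [CompleteOrthomodularLattice L] : BoolContext L where
  alg := CompleteSublattice.mk' {⊥, ⊤}
    (fun s hs => by
      by_cases h : ⊤ ∈ s
      · exact Or.inr (top_le_iff.1 (le_sSup h))
      · refine Or.inl (sSup_eq_bot.2 fun a ha => (hs ha).resolve_right ?_)
        rintro rfl
        exact h ha)
    (fun s hs => by
      by_cases h : ⊥ ∈ s
      · exact Or.inl (le_bot_iff.1 (sInf_le h))
      · refine Or.inr (sInf_eq_top.2 fun a ha => (hs ha).resolve_left ?_)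
        rintro rfl
        exact h ha)
  compl_mem := by
    rintro a (rfl | rfl)
    · exact Or.inr ocompl_bot
    · exact Or.inl ocompl_top
  distrib := by
    rintro a (rfl | rfl) b - c - <;> simp

theorem trivial_le (B : BoolContext L) : (trivial L).alg ≤ B.alg := by
  rintro a (rfl | rfl)
  · exact B.alg.bot_mem
  · exact B.alg.top_mem

theorem stoneSpace_trivial_eq (x y : StoneSpace (trivial L)) : x = y := by
  refine DFunLike.ext (F := BoundedLatticeHom (trivial L).alg Bool) x y ?_
  rintro ⟨a, rfl | rfl⟩
  · exact (map_bot (F := BoundedLatticeHom (trivial L).alg Bool) x).trans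
      (map_bot (F := BoundedLatticeHom (trivial L).alg Bool) y).symm
  · exact (map_top (F := BoundedLatticeHom (trivial L).alg Bool) x).trans
      (map_top (F := BoundedLatticeHom (trivial L).alg Bool) y).symm

end BoolContext

namespace StoneSpace

variable {L : Type u} [CompleteOrthomodularLattice L] {B : BoolContext L}

/-- Stone separation turns disjointness into `c ⊓ d = ⊥`. Distributivity inside the context then
gives the inequality, which orthomodularity alone would not. -/
theorem le_ctxCompl_of_disjoint {c d : B.alg} (h : Disjoint (basic c) (basic d)) :
    c ≤ ctxCompl d := by
  have hcd : c ⊓ d = ⊥ := by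
    by_contra h0
    obtain ⟨y, hy⟩ := basic_nonempty h0
    exact Set.disjoint_left.1 h (eval_mono y inf_le_left hy) (eval_mono y inf_le_right hy)
  let _ : DistribLattice B.alg := distribLattice B
  calc c = c ⊓ (d ⊔ ctxCompl d) := by rw [sup_ctxCompl]; simp
    _ = (c ⊓ d) ⊔ (c ⊓ ctxCompl d) := inf_sup_left _ _ _
    _ = c ⊓ ctxCompl d := by rw [hcd]; simp
    _ ≤ ctxCompl d := inf_le_right

end StoneSpace

namespace SubCl

variable {L : Type u} [CompleteOrthomodularLattice L]

theorem obj_bot (B : BoolContext L) : (⊥ : SubCl L).obj B = ∅ := by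
  let S : SubCl L := ⟨fun _ => ∅, fun _ => isClopen_empty, fun _ _ _ _ hx => hx⟩
  exact Set.subset_empty_iff.1 ((bot_le : ⊥ ≤ S) B)

/-- Any point over any context restricts to the trivial context, so a subobject empty there is empty
everywhere. -/
theorem exists_mem_trivial_of_ne_bot {S : SubCl L} (hS : S ≠ ⊥) :
    ∃ x, x ∈ S.obj (BoolContext.trivial L) := by
  by_contra! h
  refine hS (le_bot_iff.1 fun B x hx => ?_)
  exact (h _ (S.restrict_mem B _ B.trivial_le x hx)).elim

/-- The frame of clopen subobjects has no zero divisors. -/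
theorem eq_bot_or_eq_bot_of_inf_eq_bot {S T : SubCl L} (h : S ⊓ T = ⊥) : S = ⊥ ∨ T = ⊥ := by
  by_contra! hne
  obtain ⟨x, hx⟩ := exists_mem_trivial_of_ne_bot hne.1
  obtain ⟨y, hy⟩ := exists_mem_trivial_of_ne_bot hne.2
  rw [BoolContext.stoneSpace_trivial_eq y x] at hy
  have hxy : x ∈ (S ⊓ T).obj (BoolContext.trivial L) := ⟨hx, hy⟩
  rw [h, obj_bot] at hxy
  exact hxy

/-! ### Daseinisation, its upper adjoint and the implication of `*` -/

theorem le_coe_sInf (B : BoolContext L) (a : L) : a ≤ (sInf {b : B.alg | a ≤ b.1} : B.alg).1 := by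
  rw [CompleteSublattice.coe_sInf']
  exact le_iInf₂ fun b hb => hb

theorem das_mono : Monotone (das : L → SubCl L) := fun _ _ h B x hx =>
  StoneSpace.eval_mono x (sInf_le (h.trans (le_coe_sInf B _))) hx

/-- A point outside the closed set `S.obj B` has a basic neighbourhood `basic d` missing it. Then
`dᶜ` bounds every `a` with `das a ≤ S`, hence also their supremum `eps S`, so the point cannot lie
in `das (eps S)`. -/
theorem das_eps_le (S : SubCl L) : das (eps S) ≤ S := by
  intro B x hx
  by_contra hxS
  obtain ⟨d, hxd, hd⟩ := StoneSpace.exists_basic (S.isClopen B).1.isOpen_compl hxS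
  have hle : eps S ≤ (StoneSpace.ctxCompl d).1 := by
    refine sSup_le fun a ha => (le_coe_sInf B a).trans ?_
    exact StoneSpace.le_ctxCompl_of_disjoint
      (Set.disjoint_left.2 fun y hy hyd => hd hyd (ha B hy))
  have h1 : x.eval (StoneSpace.ctxCompl d) = true := StoneSpace.eval_mono x (sInf_le hle) hx
  have h2 : x.eval d = true := hxd
  simp [StoneSpace.eval_ctxCompl, h2] at h1

/-- Daseinisation is left adjoint to `eps`. -/
theorem gc_das_eps : GaloisConnection (das : L → SubCl L) eps := fun _ S =>
  ⟨fun h => le_sSup h, fun h => (das_mono h).trans (das_eps_le S)⟩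

/-- The trivial context suffices: only `⊥` has upper approximation `⊥` there. -/
theorem eps_bot : eps (⊥ : SubCl L) = ⊥ := by
  refine sSup_eq_bot.2 fun a ha => ?_
  have h : sInf {b : (BoolContext.trivial L).alg | a ≤ b.1} = ⊥ := by
    by_contra h0
    obtain ⟨x, hx⟩ := StoneSpace.basic_nonempty h0
    have := ha (BoolContext.trivial L) hx
    rw [obj_bot] at this
    exact this
  have h1 := le_coe_sInf (BoolContext.trivial L) a
  rw [h] at h1
  exact le_bot_iff.1 h1

/-- Approximating from above enlarges both `a` and `aᶜ`, so their join stays `⊤` in every context,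
and a homomorphism to `{0, 1}` sends one of the two to `1`. -/
theorem das_ocompl_sup_das (a : L) : das aᶜ ⊔ das a = ⊤ := by
  refine top_le_iff.1 fun B x _ => ?_
  have h : sInf {b : B.alg | aᶜ ≤ b.1} ⊔ sInf {b : B.alg | a ≤ b.1} = ⊤ := by
    refine top_le_iff.1 ?_
    change (⊤ : L) ≤ _
    rw [← CompleteOrthomodularLattice.sup_ocompl_self a, sup_comm]
    exact sup_le_sup (le_coe_sInf B _) (le_coe_sInf B _)
  have h2 := StoneSpace.eval_sup x (sInf {b : B.alg | aᶜ ≤ b.1}) (sInf {b : B.alg | a ≤ b.1})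
  rw [h, StoneSpace.eval_top] at h2
  rcases Bool.or_eq_true_iff.1 h2.symm with h3 | h3
  · exact (le_sup_left : das aᶜ ≤ das aᶜ ⊔ das a) B h3
  · exact (le_sup_right : das a ≤ das aᶜ ⊔ das a) B h3

theorem starImp_eq_top {S T : SubCl L} (h : das (eps S) ≤ T) : starImp S T = ⊤ :=
  top_le_iff.1 ((das_ocompl_sup_das (eps S)).ge.trans (sup_le_sup_left h _))

theorem starImp_mono_right (S : SubCl L) : Monotone (starImp S) := fun _ _ h =>
  sup_le_sup_left h _

/-- Only the excluded middle `S ⊔ star S = ⊤` is needed: split `S ⇨ T` along it and use modus ponens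
on the part in `S`. -/
theorem himp_le_starImp (S T : SubCl L) : S ⇨ T ≤ starImp S T := by
  have h : S ⊔ star S = ⊤ :=
    top_le_iff.1 ((starImp_eq_top (das_eps_le S)).ge.trans (sup_comm _ _).le)
  calc S ⇨ T = (S ⇨ T) ⊓ (S ⊔ star S) := by rw [h, inf_top_eq]
    _ = (S ⇨ T) ⊓ S ⊔ (S ⇨ T) ⊓ star S := inf_sup_left _ _ _
    _ ≤ star S ⊔ T := sup_le (himp_inf_le.trans le_sup_right) (inf_le_right.trans le_sup_left)

theorem starImp_bot (T : SubCl L) : starImp ⊥ T = ⊤ :=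
  starImp_eq_top ((das_eps_le _).trans bot_le)

end SubCl

/-! ## Rational numbers as hereditarily finite sets -/

theorem PSet.rank_ofNat (n : ℕ) : (PSet.ofNat.{u} n).rank = n := by
  induction n with
  | zero => simp [PSet.ofNat]
  | succ n ih => simp [PSet.ofNat, PSet.rank_insert, ih]

theorem PSet.ofNat_injective {m n : ℕ} (h : (PSet.ofNat.{u} m).Equiv (PSet.ofNat.{u} n)) : m = n := by
  have := PSet.rank_congr h
  simpa [PSet.rank_ofNat] using this

theorem setPair_inj {x y x' y' : PSet.{u}} (h : (setPair x y).Equiv (setPair x' y')) :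
    x.Equiv x' ∧ y.Equiv y' := by
  have h1 : ZFSet.pair (ZFSet.mk x) (ZFSet.mk y) = ZFSet.pair (ZFSet.mk x') (ZFSet.mk y') :=
    ZFSet.sound h
  exact (ZFSet.pair_inj.1 h1).imp ZFSet.exact ZFSet.exact

theorem ratSet_injective {q r : ℚ} (h : (ratSet.{u} q).Equiv (ratSet.{u} r)) : q = r := by
  obtain ⟨h1, h2⟩ := setPair_inj h
  obtain ⟨h3, h4⟩ := setPair_inj h1
  have h2 := PSet.ofNat_injective h2
  have h3 := PSet.ofNat_injective h3
  have h4 := PSet.ofNat_injective h4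
  -- An integer is determined by its positive and negative parts.
  exact Rat.ext (by omega) h2

/-! ## Heyting valued equality -/

namespace AName

variable {A : Type u}

theorem eqVal_eq [CompleteLattice A] (imp : A → A → A) (u v : AName A) :
    eqVal imp u v = (⨅ i, imp (u.val i) (⨆ j, v.val j ⊓ eqVal imp (u.dom i) (v.dom j))) ⊓
      (⨅ j, imp (v.val j) (⨆ i, u.val i ⊓ eqVal imp (u.dom i) (v.dom j))) := by
  cases u
  cases v
  rw [eqVal]
  rfl

theorem eqVal_comm [CompleteLattice A] (imp : A → A → A) (u v : AName A) :
    eqVal imp u v = eqVal imp v u := by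
  induction u generalizing v with
  | mk ι x a ih =>
    cases v with
    | mk κ y b =>
      rw [eqVal, eqVal, inf_comm]
      simp only [ih]

/-- The recursion enters only the second argument of the implication, so monotonicity there
suffices. -/
theorem eqVal_le_eqVal [CompleteLattice A] {imp imp' : A → A → A}
    (hle : ∀ a b, imp a b ≤ imp' a b) (hmono : ∀ a, Monotone (imp' a)) (u v : AName A) :
    eqVal imp u v ≤ eqVal imp' u v := by
  induction u generalizing v with
  | mk ι x a ih =>
    cases v with
    | mk κ y b =>
      rw [eqVal, eqVal]
      refine inf_le_inf (iInf_mono fun i => (hle _ _).trans (hmono _ ?_))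
        (iInf_mono fun j => (hle _ _).trans (hmono _ ?_))
      · exact iSup_mono fun j => inf_le_inf_left _ (ih i _)
      · exact iSup_mono fun i => inf_le_inf_left _ (ih i _)

variable [Order.Frame A]

theorem val_inf_eqVal_le (u v : AName A) (i : u.Idx) :
    u.val i ⊓ eqVal (· ⇨ ·) u v ≤ ⨆ j, v.val j ⊓ eqVal (· ⇨ ·) (u.dom i) (v.dom j) := by
  rw [eqVal_eq, inf_comm, ← le_himp_iff]
  exact inf_le_left.trans (iInf_le _ i)

theorem eqVal_trans (u v w : AName A) :
    eqVal (· ⇨ ·) u v ⊓ eqVal (· ⇨ ·) v w ≤ eqVal (· ⇨ ·) u w := by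
  induction u generalizing v w with
  | mk ι x a ih =>
    set u : AName A := mk ι x a with hu
    have ih' : ∀ (i : u.Idx) (v w : AName A),
        eqVal (· ⇨ ·) (u.dom i) v ⊓ eqVal (· ⇨ ·) v w ≤ eqVal (· ⇨ ·) (u.dom i) w := ih
    rw [eqVal_eq _ u w]
    refine le_inf (le_iInf fun i => ?_) (le_iInf fun k => ?_)
    · rw [le_himp_iff]
      calc eqVal (· ⇨ ·) u v ⊓ eqVal (· ⇨ ·) v w ⊓ u.val i
          = (u.val i ⊓ eqVal (· ⇨ ·) u v) ⊓ eqVal (· ⇨ ·) v w := by ac_rfl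
        _ ≤ (⨆ j, v.val j ⊓ eqVal (· ⇨ ·) (u.dom i) (v.dom j)) ⊓ eqVal (· ⇨ ·) v w :=
          inf_le_inf_right _ (val_inf_eqVal_le u v i)
        _ ≤ _ := by
          rw [iSup_inf_eq]
          refine iSup_le fun j => ?_
          calc v.val j ⊓ eqVal (· ⇨ ·) (u.dom i) (v.dom j) ⊓ eqVal (· ⇨ ·) v w
              = eqVal (· ⇨ ·) (u.dom i) (v.dom j) ⊓ (v.val j ⊓ eqVal (· ⇨ ·) v w) := by ac_rfl
            _ ≤ _ := inf_le_inf_left _ (val_inf_eqVal_le v w j)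
            _ ≤ _ := by
              rw [inf_iSup_eq]
              refine iSup_mono fun k => ?_
              rw [inf_left_comm]
              exact inf_le_inf_left _ (ih' i _ _)
    · rw [le_himp_iff]
      -- The chain runs backwards from `w` through `v` to `u`; symmetry then turns it round, because
      -- the induction hypothesis needs the member of `u` on the left.
      calc eqVal (· ⇨ ·) u v ⊓ eqVal (· ⇨ ·) v w ⊓ w.val k
          = (w.val k ⊓ eqVal (· ⇨ ·) w v) ⊓ eqVal (· ⇨ ·) v u := by
            rw [eqVal_comm _ w v, eqVal_comm _ v u]; ac_rfl
        _ ≤ (⨆ j, v.val j ⊓ eqVal (· ⇨ ·) (w.dom k) (v.dom j)) ⊓ eqVal (· ⇨ ·) v u :=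
          inf_le_inf_right _ (val_inf_eqVal_le w v k)
        _ ≤ _ := by
          rw [iSup_inf_eq]
          refine iSup_le fun j => ?_
          calc v.val j ⊓ eqVal (· ⇨ ·) (w.dom k) (v.dom j) ⊓ eqVal (· ⇨ ·) v u
              = eqVal (· ⇨ ·) (w.dom k) (v.dom j) ⊓ (v.val j ⊓ eqVal (· ⇨ ·) v u) := by ac_rfl
            _ ≤ _ := inf_le_inf_left _ (val_inf_eqVal_le v u j)
            _ ≤ _ := by
              rw [inf_iSup_eq]
              refine iSup_mono fun i => ?_
              rw [inf_left_comm, eqVal_comm _ (w.dom k), eqVal_comm _ (v.dom j) (u.dom i), inf_comm (eqVal _ _ _)]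
              exact inf_le_inf_left _ (ih' i _ _)

theorem eqVal_inf_memVal_le (x y v : AName A) :
    eqVal (· ⇨ ·) x y ⊓ memVal (· ⇨ ·) y v ≤ memVal (· ⇨ ·) x v := by
  rw [memVal, memVal, inf_iSup_eq]
  refine iSup_mono fun j => ?_
  rw [inf_left_comm]
  exact inf_le_inf_left _ (eqVal_trans _ _ _)

theorem eqVal_self (u : AName A) : eqVal (· ⇨ ·) u u = ⊤ := by
  induction u with
  | mk ι x a ih =>
    rw [eqVal, inf_eq_top_iff]
    simp only [iInf_eq_top, himp_eq_top_iff]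
    exact ⟨fun i => le_iSup_of_le i (by simp [ih]), fun i => le_iSup_of_le i (by simp [ih])⟩

theorem val_le_memVal (u : AName A) (i : u.Idx) : u.val i ≤ memVal (· ⇨ ·) (u.dom i) u :=
  le_iSup_of_le (f := fun j => u.val j ⊓ eqVal (· ⇨ ·) (u.dom i) (u.dom j)) i
    (by rw [eqVal_self, inf_top_eq])

/-- Inequivalent sets differ in a member that matches nothing on the other side; as standard names
carry only the value `⊤`, the implication for that member is `⊤ ⇨ ⊥ = ⊥`. -/
theorem eqVal_check_eq_bot {x y : PSet.{u}} (h : ¬ x.Equiv y) :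
    eqVal (· ⇨ ·) (check x : AName A) (check y) = ⊥ := by
  induction x generalizing y with
  | mk ι x ih =>
    cases y with
    | mk κ y =>
      rw [PSet.Equiv.eq_def] at h
      simp only [not_and_or, not_forall, not_exists] at h
      rw [check, check, eqVal, ← le_bot_iff]
      rcases h with ⟨i, hi⟩ | ⟨j, hj⟩
      · refine inf_le_left.trans ((iInf_le _ i).trans ?_)
        simp [ih i (hi _)]
      · refine inf_le_right.trans ((iInf_le _ j).trans ?_)
        simp [ih _ (hj _)]

theorem memVal_check_ratsSet (x : AName A) :
    memVal (· ⇨ ·) x (check ratsSet) = ⨆ q : ℚ, eqVal (· ⇨ ·) x (check (ratSet q)) := by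
  refine le_antisymm (iSup_le fun j => ?_) (iSup_le fun q => ?_)
  · exact inf_le_right.trans (le_iSup (fun q : ℚ => eqVal (· ⇨ ·) x (check (ratSet q))) j.down)
  · exact le_iSup_of_le (f := fun j => (check ratsSet).val j ⊓
      eqVal (· ⇨ ·) x ((check ratsSet).dom j)) (ULift.up q) (le_inf le_top le_rfl)

/-! ### Dedekind reals and their families -/

theorem val_le_memVal_ratsSet {u : AName A} (hu : dedekindVal u = ⊤) (i : u.Idx) :
    u.val i ≤ ⨆ q : ℚ, eqVal (· ⇨ ·) (u.dom i) (check (ratSet q)) := by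
  simp only [dedekindVal, inf_eq_top_iff, iInf_eq_top, himp_eq_top_iff] at hu
  exact (hu.1.1.1 i).trans (memVal_check_ratsSet _).le

theorem family_ratCast {u : AName A} (hu : dedekindVal u = ⊤) (q : ℚ) : family u q = ratMem u q := by
  simp only [dedekindVal, inf_eq_top_iff, iInf_eq_top, himp_eq_top_iff] at hu
  simp only [family, Rat.cast_lt]
  exact le_antisymm (hu.2 q).2 (hu.2 q).1

/-- The clause that some rational is not in `u` covers `⊤` by the complements of the values, and the
infimum meets each of these in `⊥`. -/
theorem iInf_ratMem_eq_bot {u : AName A} (hu : dedekindVal u = ⊤) : ⨅ q : ℚ, ratMem u q = ⊥ := by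
  simp only [dedekindVal, inf_eq_top_iff] at hu
  rw [← inf_top_eq (⨅ q : ℚ, ratMem u q), ← hu.1.2, inf_iSup_eq, iSup_eq_bot]
  exact fun q => le_bot_iff.1 ((inf_le_inf_right _ (iInf_le _ q)).trans (inf_compl_self _).le)

theorem iInf_family_eq_bot {u : AName A} (hu : dedekindVal u = ⊤) : ⨅ t : ℝ, family u t = ⊥ := by
  rw [← le_bot_iff, ← iInf_ratMem_eq_bot hu]
  exact le_iInf fun q => (iInf_le _ (q : ℝ)).trans (family_ratCast hu q).le

theorem iInf_family_gt (u : AName A) (t : ℝ) : ⨅ (s : ℝ) (_ : t < s), family u s = family u t := by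
  refine le_antisymm (le_iInf₂ fun q hq => ?_) (le_iInf₂ fun s hs => le_iInf₂ fun q hq => ?_)
  · obtain ⟨s, hts, hsq⟩ := exists_between hq
    exact (iInf₂_le s hts).trans (iInf₂_le q hsq)
  · exact iInf₂_le q (hs.trans hq)

/-- In a frame without zero divisors a member of a real equals a single rational. -/
theorem exists_val_le_eqVal_ratSet (hA : ∀ a b : A, a ⊓ b = ⊥ → a = ⊥ ∨ b = ⊥) {u : AName A}
    (hu : dedekindVal u = ⊤) (i : u.Idx) (hi : u.val i ≠ ⊥) :
    ∃ q : ℚ, u.val i ≤ eqVal (· ⇨ ·) (u.dom i) (check (ratSet q)) := by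
  have hle := val_le_memVal_ratsSet hu i
  obtain ⟨q, hq⟩ : ∃ q : ℚ, eqVal (· ⇨ ·) (u.dom i) (check (ratSet q)) ≠ ⊥ := by
    by_contra! h
    simp only [h, iSup_bot, le_bot_iff] at hle
    exact hi hle
  refine ⟨q, hle.trans (iSup_le fun r => ?_)⟩
  by_cases hqr : q = r
  · rw [hqr]
  -- Transitivity through the member bounds this meet by the equality of two distinct standard
  -- rationals, which is `⊥`. The value at `q` being nonzero, the one at `r` vanishes.
  · have h : eqVal (· ⇨ ·) (u.dom i) (check (ratSet q)) ⊓
        eqVal (· ⇨ ·) (u.dom i) (check (ratSet r)) = ⊥ := by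
      rw [eqVal_comm _ (u.dom i), ← le_bot_iff,
        ← eqVal_check_eq_bot (A := A) (fun h => hqr (ratSet_injective h))]
      exact eqVal_trans _ _ _
    rw [(hA _ _ h).resolve_left hq]
    exact bot_le

end AName

/-! ## Reals over the clopen subobjects -/

namespace SubCl

variable {L : Type u} [CompleteOrthomodularLattice L]

open AName

theorem eqVal_le_eqVal_starImp (u v : AName (SubCl L)) :
    eqVal (· ⇨ ·) u v ≤ eqVal starImp u v :=
  eqVal_le_eqVal himp_le_starImp starImp_mono_right u v

/-- One half of the recursion for equality. That the member equals a single rational `q` is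
essential, as the hypothesis on `eps` can only be used at one rational at a time. -/
theorem starImp_val_eq_top {u v : AName (SubCl L)} (hu : dedekindVal u = ⊤)
    (h : ∀ q : ℚ, eps (ratMem u q) = eps (ratMem v q)) (i : u.Idx) :
    starImp (u.val i) (⨆ j, v.val j ⊓ eqVal starImp (u.dom i) (v.dom j)) = ⊤ := by
  by_cases hi : u.val i = ⊥
  · rw [hi, starImp_bot]
  obtain ⟨q, hq⟩ :=
    exists_val_le_eqVal_ratSet (fun _ _ => eq_bot_or_eq_bot_of_inf_eq_bot) hu i hi
  have h1 : u.val i ≤ ratMem u q := by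
    refine le_trans (le_inf ?_ (val_le_memVal u i)) (eqVal_inf_memVal_le _ (u.dom i) _)
    rwa [eqVal_comm]
  have h2 : das (eps (u.val i)) ≤ ratMem v q := by
    refine (das_mono ((gc_das_eps.monotone_u h1).trans (h q).le)).trans (das_eps_le _)
  -- Substituting the member for `q̂` happens in Heyting valued equality, where transitivity is
  -- available; the passage to `starImp` comes last.
  refine starImp_eq_top ((le_inf ((das_eps_le _).trans hq) h2).trans
    ((eqVal_inf_memVal_le _ _ _).trans (iSup_mono fun j => inf_le_inf_left _ ?_)))
  exact eqVal_le_eqVal_starImp _ _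

theorem eqVal_starImp_eq_top {u v : AName (SubCl L)} (hu : dedekindVal u = ⊤)
    (hv : dedekindVal v = ⊤) (h : ∀ q : ℚ, eps (ratMem u q) = eps (ratMem v q)) :
    eqVal starImp u v = ⊤ := by
  rw [eqVal_eq, inf_eq_top_iff, iInf_eq_top, iInf_eq_top]
  refine ⟨starImp_val_eq_top hu h, fun j => ?_⟩
  simp only [eqVal_comm starImp _ (v.dom j)]
  exact starImp_val_eq_top hv (fun q => (h q).symm) j

theorem starImp_eq_top_of_eps_eq {S T : SubCl L} (h : eps S = eps T) : starImp S T = ⊤ :=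
  starImp_eq_top (h ▸ das_eps_le T)

end SubCl

/-- The weakly self-adjoint operator `(ε(E_t))` of a real over the clopen subobjects. -/
noncomputable def SubCl.spectralFamily {H : Type u} [NormedAddCommGroup H] [InnerProductSpace ℂ H]
    [CompleteSpace H] (u : AName.DedekindReal (SubCl (ProjLattice H))) : WSA H where
  proj t := SubCl.eps (AName.family u.1 t)
  iInf_eq := by
    have h := SubCl.gc_das_eps.u_iInf (f := fun t : ℝ => AName.family u.1 t)
    rw [AName.iInf_family_eq_bot u.2, SubCl.eps_bot] at h
    exact h.symm
  right_cont t := by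
    have h := SubCl.gc_das_eps.u_iInf₂ (f := fun (s : ℝ) (_ : t < s) => AName.family u.1 s)
    rw [AName.iInf_family_gt] at h
    exact h.symm

theorem SubCl.eps_ratMem_eq {H : Type u} [NormedAddCommGroup H] [InnerProductSpace ℂ H]
    [CompleteSpace H] {u v : AName.DedekindReal (SubCl (ProjLattice H))}
    (h : SubCl.spectralFamily u = SubCl.spectralFamily v) (q : ℚ) :
    SubCl.eps (AName.ratMem u.1 q) = SubCl.eps (AName.ratMem v.1 q) := by
  rw [← AName.family_ratCast u.2, ← AName.family_ratCast v.2]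
  exact congrFun (congrArg WSA.proj h) q

theorem mainTheorem4 {H : Type u} [NormedAddCommGroup H] [InnerProductSpace ℂ H]
    [CompleteSpace H] :
    ∃ G : AName.DedekindReal (SubCl (ProjLattice H)) → WSA H,
      (∀ (u : AName.DedekindReal (SubCl (ProjLattice H))) (t : ℝ),
        (G u).proj t = (SubCl.toClass (AName.family u.1 t)).g) ∧
      (∀ u v : AName.DedekindReal (SubCl (ProjLattice H)),
        AName.eqVal SubCl.starImp u.1 v.1 ≠ ⊤ → G u ≠ G v) ∧
      (∀ u v : AName.DedekindReal (SubCl (ProjLattice H)),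
        (⨅ q : ℚ, SubCl.starImp (AName.ratMem u.1 q) (AName.ratMem v.1 q) ⊓
          SubCl.starImp (AName.ratMem v.1 q) (AName.ratMem u.1 q)) ≠ ⊤ → G u ≠ G v) := by
  refine ⟨SubCl.spectralFamily, fun _ _ => rfl, fun u v hne h => hne ?_, fun u v hne h => hne ?_⟩
  · exact SubCl.eqVal_starImp_eq_top u.2 v.2 (SubCl.eps_ratMem_eq h)
  · refine iInf_eq_top.2 fun q => ?_
    rw [SubCl.starImp_eq_top_of_eps_eq (SubCl.eps_ratMem_eq h q),
      SubCl.starImp_eq_top_of_eps_eq (SubCl.eps_ratMem_eq h q).symm, inf_top_eq]
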